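/- Let $G_0$ be a finite undirected unweighted graph from which edges are deleted one at a time; let $G=G_k$ be the graph after $k$ deletions and $\mathbf{dist}$ its distance. Let $0<\epsilon\le 1$, $\zeta\ge 1$, $\beta=(2/\epsilon)\zeta$ (in the application $\zeta=n^{\sqrt{6/\epsilon}/\sqrt{\log n}}$). Let $Q\subseteq V$ and $S_i\subseteq V$ be sets of vertices. For each $q\in Q$ and each $k$ let $H=H_{q,k}$ be any weighted graph on $V$ which is a $(1+\epsilon/2,\zeta)$-emulator of $G_k$, i.e. $\mathbf{dist}(x,y)\le\mathbf{dist}(x,y,H)\le(1+\epsilon/2)\,\mathbf{dist}(x,y)+\zeta$ for all $x,y$, and put $\mathbf{dist}^{BR}_q(x,y)=\mathbf{dist}(q,x,H)+\mathbf{dist}(q,y,H)$. Let $\mathbf{dist}_Q(x,y)=\min_{q\in Q}(\mathbf{dist}(x,q)+\mathbf{dist}(q,y))$ and $\mathbf{dist}(x,Q)=\min_{q\in Q}\mathbf{dist}(x,q)$. For $s\in S_i$ and $x\in V$ the heap $\mathbf{Heap}^*_{(x,s)}$ initially stores, for the keys $q\in Q$, those values $\mathbf{dist}^{BR}_q(x,s)$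 that are at most $(1+\epsilon)2^i$; after each deletion a stored value is replaced by the current value of $\mathbf{dist}^{BR}_q(x,s)$ if that is larger (decreases are ignored), and a key is removed permanently when its value exceeds $(1+\epsilon)2^i$. Minima over the empty set are $\infty$. For a tree $T$ with root $s$ and a vertex $v\notin T$ let $d(v)=d(v,s,B(T,1))$ be the minimum of $\mathbf{dist}(s,x,T)+1$ over the neighbours $x\in T$ of $v$ in $G$. The vertex $v$ is *not light for $(s,T)$* if one of the following holds: 1. $d(v)\le 8\beta/\epsilon$ and $d(v)\ge\mathbf{dist}_Q(v,s)-2$; 2. $d(v)>8\beta/\epsilon$, $\mathbf{dist}(v,Q)\ge\beta$, and there is $w\notin T$ with $\mathbf{dist}(v,w)\le\beta$ and $d(v)\ge\mathbf{dist}(v,w)+\min(\mathbf{Heap}^*_{(w,s)})/(1+\epsilon)$; 3. $d(v)>8\beta/\epsilon$ and $d(v)\ge\min(\mathbf{Heap}^*_{(v,s)})/(1+\epsilon)$. For $s\in S_i$ the tree $T(s)$ is maintained up to depth $2^i$ as a King tree restricted to vertices that pass the test. It starts as $\{s\}$ with no earlier tree distances. When an edge is deleted, the part of $T(s)$ that is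 still connected to $s$ is kept. Initially and after each deletion, the following two operations are carried out until neither applies, and only then is the next edge deleted. (a) A vertex $y\notin T(s)$ which was in the tree just before the deletion and has $d(y)$ not larger than its distance in the tree at that time is reconnected, without a test, by a best edge (one that realizes $d(y)$). (b) A vertex $y\notin T(s)$ with $d(y)\le 2^i$ for which it is not the case that $y$ is not light for $(s,T(s))$ is connected by a best edge; operation (b) is applied only to a vertex $y$ whose $d(y)$ is smallest among all vertices to which (a) or (b) currently applies. Then, at every moment of every run (also between the operations of one update), every vertex $u$ in $T(s)$ satisfies $\mathbf{dist}(u,s,T(s))=\mathbf{dist}(u,s)$. Consequently distances in $T(s)$ never decrease: if $u$ is in $T(s)$ at some moment and at a later moment, then its distance to $s$ in the later tree is at least that in the earlier one. -/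

import Mathlib

open scoped NNReal ENNReal

namespace LightTree

variable {V : Type*}

/-- A weighted undirected graph on the vertex set `V` (used as an emulator). -/
structure WeightedGraph (V : Type*) where
  graph : SimpleGraph V
  weight : Sym2 V → ℝ≥0

/-- Weighted shortest path distance; `∞` if the vertices are not connected. -/
noncomputable def WeightedGraph.dist (H : WeightedGraph V) (x y : V) : ℝ≥0∞ :=
  ⨅ p : H.graph.Walk x y, (((p.edges.map H.weight).sum : ℝ≥0) : ℝ≥0∞)

/-- `H` is a `(1 + ε/2, ζ)`-emulator of the unweighted graph `G`. -/
def IsEmulator (G : SimpleGraph V) (H : WeightedGraph V) (ε ζ : ℝ≥0) : Prop :=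
  ∀ x y : V, (G.edist x y : ℝ≥0∞) ≤ H.dist x y ∧
    H.dist x y ≤ (1 + (ε : ℝ≥0∞) / 2) * (G.edist x y : ℝ≥0∞) + ζ

/-- What the trees depend on: the initial graph, the sequence of deleted edges, the set `Q`,
the weighted graphs `H q k` (the emulator held by the `(1+ε)`-approximate single source structure
of `q` after `k` deletions), and the parameters `ε`, `ζ`. -/
structure Input (V : Type*) where
  G₀ : SimpleGraph V
  deleted : ℕ → Sym2 V
  Q : Finset V
  H : V → ℕ → WeightedGraph V
  ε : ℝ≥0
  ζ : ℝ≥0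

namespace Input

variable (D : Input V)

/-- The graph after the first `k` deletions. -/
def graph : ℕ → SimpleGraph V
  | 0 => D.G₀
  | k + 1 => (graph k).deleteEdges {D.deleted k}

/-- `β = (2/ε) ζ`. -/
noncomputable def β : ℝ≥0 := 2 / D.ε * D.ζ

/-- The threshold `8β/ε` between short and long distances. -/
noncomputable def threshold : ℝ≥0 := 8 * D.β / D.ε

/-- Exact distance in the graph after `k` deletions, as an extended nonnegative real. -/
noncomputable def dist (k : ℕ) (x y : V) : ℝ≥0∞ := ((D.graph k).edist x y : ℝ≥0∞)

/-- `dist(x, Q)`. -/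
noncomputable def distToQ (k : ℕ) (x : V) : ℝ≥0∞ := ⨅ q ∈ D.Q, D.dist k x q

/-- `dist_Q(x, y)`: the smallest value of `dist(x, q) + dist(q, y)` over `q ∈ Q`. -/
noncomputable def distQ (k : ℕ) (x y : V) : ℝ≥0∞ := ⨅ q ∈ D.Q, D.dist k x q + D.dist k q y

/-- `dist_q^{BR}(x, y)`: the sum of the estimated distances from `q` to `x` and to `y`. -/
noncomputable def distBR (q : V) (k : ℕ) (x y : V) : ℝ≥0∞ :=
  (D.H q k).dist q x + (D.H q k).dist q y

/-- The largest value kept in the heaps of index `i`, namely `(1+ε) 2^i`. -/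
noncomputable def cap (i : ℕ) : ℝ≥0∞ := (1 + (D.ε : ℝ≥0∞)) * 2 ^ i

open Classical in
/-- `Heap^{(*,1+ε)}_{(x,y)}[q]` of index `i` after `k` deletions; `∞` means that the key `q` is
absent. Values above the cap are not stored; an increase over the stored value is recorded, a
decrease is ignored, and a key whose value exceeds the cap is removed permanently. -/
noncomputable def heap (i : ℕ) (x y q : V) : ℕ → ℝ≥0∞
  | 0 => if D.distBR q 0 x y ≤ D.cap i then D.distBR q 0 x y else ∞
  | k + 1 =>
    if heap i x y q k < D.distBR q (k + 1) x y then
      if D.distBR q (k + 1) x y ≤ D.cap i then D.distBR q (k + 1) x y else ∞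
    else heap i x y q k

/-- `min (Heap^{(*,1+ε)}_{(x,y)})`, which is `∞` for the empty heap. -/
noncomputable def minHeap (i k : ℕ) (x y : V) : ℝ≥0∞ := ⨅ q ∈ D.Q, D.heap i x y q k

end Input

/-- The vertex `u` belongs to the tree with root `s` and edge set `T`. (In the states below all
edges of `T` lie in the connected component of `s`.) -/
def InTree (s : V) (T : SimpleGraph V) (u : V) : Prop := T.Reachable s u

/-- `d(v, s, B(T,1))`: the smallest value of `dist(s, x, T) + 1` over the neighbours `x` in `G`
of `v` that belong to `T`; `∞` if there is none. -/
noncomputable def bdist (G : SimpleGraph V) (s : V) (T : SimpleGraph V) (v : V) : ℕ∞ :=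
  ⨅ (x : V) (_ : G.Adj v x ∧ InTree s T x), T.edist s x + 1

/-- `v` is not light for `(s, T)`, after `k` deletions. -/
def NotLight (D : Input V) (i : ℕ) (s : V) (k : ℕ) (T : SimpleGraph V) (v : V) : Prop :=
  let d : ℝ≥0∞ := (bdist (D.graph k) s T v : ℝ≥0∞)
  (d ≤ D.threshold ∧ D.distQ k v s ≤ d + 2) ∨
  ((D.threshold : ℝ≥0∞) < d ∧ (D.β : ℝ≥0∞) ≤ D.distToQ k v ∧
    ∃ w : V, D.dist k v w ≤ D.β ∧ ¬ InTree s T w ∧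
      D.dist k v w + D.minHeap i k w s / (1 + (D.ε : ℝ≥0∞)) ≤ d) ∨
  ((D.threshold : ℝ≥0∞) < d ∧ D.minHeap i k v s / (1 + (D.ε : ℝ≥0∞)) ≤ d)

/-- A state of the maintenance of the tree `T(s)`: the number of deletions so far, the edges of
the tree, and the distance in the tree that each vertex had just before the last deletion
(`∞` for the vertices that were not in the tree). -/
structure State (V : Type*) where
  time : ℕ
  tree : SimpleGraph V
  old : V → ℕ∞

/-- The state before the tree is first built: only the root is in the tree. -/
def State.init (V : Type*) : State V where
  time := 0
  tree := ⊥
  old := fun _ => ⊤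

/-- Remove the edge `e` from the tree and keep what is still connected to the root. -/
def cutTree (s : V) (T : SimpleGraph V) (e : Sym2 V) : SimpleGraph V where
  Adj a b := (T.deleteEdges {e}).Adj a b ∧ (T.deleteEdges {e}).Reachable s a
  symm := ⟨fun _ _ h => ⟨h.1.symm, h.2.trans h.1.reachable⟩⟩
  loopless := ⟨fun _ h => h.1.ne rfl⟩

/-- The vertex `y`, cut off by the last deletion, can be reconnected without increasing its
distance in the tree. -/
def CanKeep (D : Input V) (s : V) (σ : State V) (y : V) : Prop :=
  ¬ InTree s σ.tree y ∧ σ.old y ≠ ⊤ ∧ bdist (D.graph σ.time) s σ.tree y ≤ σ.old y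

/-- The vertex `y` outside the tree can be connected at distance at most `2^i` and passes the
test. -/
def CanAccept (D : Input V) (i : ℕ) (s : V) (σ : State V) (y : V) : Prop :=
  ¬ InTree s σ.tree y ∧ bdist (D.graph σ.time) s σ.tree y ≤ 2 ^ i ∧
    ¬ NotLight D i s σ.time σ.tree y

/-- `x` is the endpoint in the tree of a best edge for connecting `y`. -/
def IsBest (D : Input V) (s : V) (σ : State V) (y x : V) : Prop :=
  (D.graph σ.time).Adj y x ∧ InTree s σ.tree x ∧
    σ.tree.edist s x + 1 = bdist (D.graph σ.time) s σ.tree y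

/-- The elementary steps of the maintenance of `T(s)`.
* `keep`: a vertex whose distance in the tree does not increase is reconnected by a best edge,
  without a test;
* `accept`: a vertex that passes the test is connected by a best edge; the vertices are treated
  in the order of the distance that they would get;
* `delete`: when nothing remains to be connected, the next edge is deleted. -/
inductive Step (D : Input V) (i : ℕ) (s : V) : State V → State V → Prop
  | keep (σ : State V) (y x : V) (hy : CanKeep D s σ y) (hx : IsBest D s σ y x) :
      Step D i s σ { σ with tree := σ.tree ⊔ SimpleGraph.edge x y }
  | accept (σ : State V) (y x : V) (hy : CanAccept D i s σ y) (hx : IsBest D s σ y x)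
      (hmin : ∀ z : V, CanKeep D s σ z ∨ CanAccept D i s σ z →
        bdist (D.graph σ.time) s σ.tree y ≤ bdist (D.graph σ.time) s σ.tree z) :
      Step D i s σ { σ with tree := σ.tree ⊔ SimpleGraph.edge x y }
  | delete (σ : State V) (hdone : ∀ z : V, ¬ CanKeep D s σ z ∧ ¬ CanAccept D i s σ z) :
      Step D i s σ
        { time := σ.time + 1
          tree := cutTree s σ.tree (D.deleted σ.time)
          old := fun v => σ.tree.edist s v }

/-- `τ` is a later state (or the same) of the maintenance of `T(s)` than `σ`. -/
def Later (D : Input V) (i : ℕ) (s : V) : State V → State V → Prop :=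
  Relation.ReflTransGen (Step D i s)

/-- `σ` occurs in some run of the maintenance of `T(s)` up to depth `2^i`. -/
def Occurs (D : Input V) (i : ℕ) (s : V) (σ : State V) : Prop :=
  Later D i s (State.init V) σ

end LightTree

namespace LightTree

open SimpleGraph

/-! ### Triangle inequalities and what a heap value records. -/

section Distances

variable {V : Type*}

/-! Tree distances are never below graph distances, so it suffices that no vertex is ever attached
too far from the root (`Invariant`). A deletion leaves the tree distances of surviving vertices
unchanged, while graph distances only grow. A reconnected vertex gets at most its old tree distance,
which was exact in an earlier graph.

The real case is a tested vertex `y`. If `d(y) > dist(s, y)`, let `b` be the first vertex outside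
the tree on a shortest path from `s` to `y` (`exists_exit`). Then `d(b) < d(y)`, so by the order of
treatment `b` must have failed the test. But failure is inherited along the path (`NotLight.of_lt`):
whatever witnesses it for `b` can be reached from `y` through `b`, at total cost at most `dist(s,
y)`, up to an additive 2 in the short-distance case. Hence `y` fails too, a contradiction.

Inheritance works because emulator errors are absorbed in two ways: the threshold `8β/ε` pays for
detours of length `2β`, and `ζ = (ε/2)β` is at most an `ε/2` fraction of any distance that is at
least `β`. -/

theorem WeightedGraph.dist_triangle (H : WeightedGraph V) (x y z : V) :
    H.dist x z ≤ H.dist x y + H.dist y z := by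
  rw [WeightedGraph.dist, WeightedGraph.dist, WeightedGraph.dist, ENNReal.iInf_add]
  refine le_iInf fun p => ?_
  rw [ENNReal.add_iInf]
  refine le_iInf fun r => iInf_le_of_le (p.append r) ?_
  simp [Walk.edges_append]

variable (D : Input V)

theorem Input.graph_antitone : Antitone D.graph :=
  antitone_nat_of_succ_le fun _ => deleteEdges_le _

theorem Input.dist_mono {j k : ℕ} (h : j ≤ k) (x y : V) : D.dist j x y ≤ D.dist k x y :=
  ENat.toENNReal_le.2 (edist_anti (D.graph_antitone h))

theorem Input.dist_comm (k : ℕ) (x y : V) : D.dist k x y = D.dist k y x := by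
  rw [Input.dist, Input.dist, edist_comm]

theorem Input.dist_triangle (k : ℕ) (x y z : V) :
    D.dist k x z ≤ D.dist k x y + D.dist k y z := by
  simp only [Input.dist]
  exact_mod_cast ENat.toENNReal_le.2 (SimpleGraph.edist_triangle (G := D.graph k) (v := y))

theorem Input.distQ_le_add (k : ℕ) (x y z : V) :
    D.distQ k x z ≤ D.dist k x y + D.distQ k y z := by
  simp only [Input.distQ, ENNReal.add_iInf]
  refine le_iInf fun q => le_iInf fun hq => (iInf₂_le q hq).trans ?_
  rw [← add_assoc]
  gcongr
  exact D.dist_triangle k x y q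

/-- A stored value is the maximum of the estimates so far, unless its key was dropped. A bound valid
at every time and below the cap therefore rules out dropping and bounds the value. -/
theorem Input.heap_le {i : ℕ} {x y q : V} {k : ℕ} {B : ℝ≥0∞}
    (h : ∀ j ≤ k, D.distBR q j x y ≤ B) (hB : B ≤ D.cap i) : D.heap i x y q k ≤ B := by
  induction k with
  | zero => rw [Input.heap, if_pos ((h 0 le_rfl).trans hB)]; exact h 0 le_rfl
  | succ k ih =>
    rw [Input.heap, if_pos ((h _ le_rfl).trans hB)]
    split_ifs
    · exact h _ le_rfl
    · exact ih fun j hj => h j (by omega)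

theorem Input.distBR_le_heap (i : ℕ) (x y q : V) {j k : ℕ} (hjk : j ≤ k) :
    D.distBR q j x y ≤ D.heap i x y q k := by
  induction k with
  | zero =>
    obtain rfl : j = 0 := by omega
    rw [Input.heap]
    split_ifs
    · exact le_rfl
    · exact le_top
  | succ k ih =>
    rw [Input.heap]
    rcases Nat.lt_or_ge k j with hj | hj
    · obtain rfl : j = k + 1 := by omega
      split_ifs with h1
      · exact le_rfl
      · exact le_top
      · exact not_lt.1 h1
    · have := ih hj
      split_ifs with h1
      · exact this.trans h1.le
      · exact le_top
      · exact this

/-- A finite minimum of the heap is attained. -/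
theorem Input.exists_heap_le_minHeap {i k : ℕ} {x y : V} (h : D.minHeap i k x y ≠ ⊤) :
    ∃ q ∈ D.Q, D.heap i x y q k ≤ D.minHeap i k x y := by
  have hne : D.Q.Nonempty := by
    by_contra hQ
    rw [Finset.not_nonempty_iff_eq_empty] at hQ
    exact h (by simp [Input.minHeap, hQ])
  obtain ⟨q, hq, hmin⟩ := D.Q.exists_min_image (fun q => D.heap i x y q k) hne
  exact ⟨q, hq, le_iInf₂ hmin⟩

theorem Input.minHeap_div_le {i k : ℕ} {x y q : V} (hq : q ∈ D.Q) {d : ℝ≥0∞} (hd : d ≤ 2 ^ i)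
    (h : ∀ j ≤ k, D.distBR q j x y ≤ (1 + (D.ε : ℝ≥0∞)) * d) :
    D.minHeap i k x y / (1 + (D.ε : ℝ≥0∞)) ≤ d := by
  refine ENNReal.div_le_of_le_mul ?_
  rw [mul_comm]
  refine (iInf₂_le q hq).trans (D.heap_le h ?_)
  unfold Input.cap
  gcongr

end Distances

/-! ### Arithmetic of `ε`, `ζ`, `β` and the threshold. -/

section Parameters

variable {V : Type*} {D : Input V}

theorem Input.half_ε_mul_β (hε : 0 < D.ε) : D.ε / 2 * D.β = D.ζ := by
  have := hε.ne'
  rw [Input.β]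
  field_simp

theorem Input.two_le_β (hε : 0 < D.ε) (hε1 : D.ε ≤ 1) (hζ : 1 ≤ D.ζ) : 2 ≤ D.β := by
  have h := D.half_ε_mul_β hε
  rw [← NNReal.coe_le_coe] at *
  rw [← NNReal.coe_inj] at h
  push_cast at *
  nlinarith [D.β.coe_nonneg, mul_le_mul_of_nonneg_right hε1 D.β.coe_nonneg]

/-- With `2ζ = εβ` the excess over `(1 + ε/2)d` is `2β + 2εβ ≤ 4β`, and `4β < (ε/2)d` above the
threshold. -/
theorem Input.stretch_le (hε : 0 < D.ε) (hε1 : D.ε ≤ 1) {d : ℝ≥0}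
    (hd : D.threshold < d) :
    (1 + D.ε / 2) * (d + 2 * D.β) + 2 * D.ζ ≤ (1 + D.ε) * d := by
  rw [← D.half_ε_mul_β hε]
  have h : 8 * D.β < d * D.ε := by rwa [Input.threshold, div_lt_iff₀ hε] at hd
  rw [← NNReal.coe_lt_coe] at h
  rw [← NNReal.coe_le_coe] at *
  push_cast at *
  nlinarith [D.β.coe_nonneg, mul_le_mul_of_nonneg_right hε1 D.β.coe_nonneg]

end Parameters

/-! ### Failure of the test is inherited along shortest paths. -/

section Light

variable {V : Type*} {D : Input V} {i k : ℕ} {s y w : V}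

/-- Distances only increase under deletions, so a current bound on the route through `q` holds at
all earlier times, as the history-dependent heap requires. The multiplicative and additive errors
fit into `1 + ε` because `d` is above the threshold. -/
theorem Input.minHeap_div_le_of_near (hε : 0 < D.ε) (hε1 : D.ε ≤ 1)
    (hH : ∀ q ∈ D.Q, ∀ k : ℕ, IsEmulator (D.graph k) (D.H q k) D.ε D.ζ)
    {d : ℝ≥0∞} (hd : d ≤ 2 ^ i) (hthr : (D.threshold : ℝ≥0∞) < d) {q : V} (hq : q ∈ D.Q)
    (h : D.dist k y q + D.dist k q s ≤ d + 2 * D.β) :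
    D.minHeap i k y s / (1 + (D.ε : ℝ≥0∞)) ≤ d := by
  refine D.minHeap_div_le hq hd fun j hj => ?_
  have hd_top : d ≠ ⊤ := ne_top_of_le_ne_top (by finiteness) hd
  lift d to ℝ≥0 using hd_top
  calc D.distBR q j y s
      ≤ ((1 + (D.ε : ℝ≥0∞) / 2) * D.dist j q y + D.ζ) +
          ((1 + (D.ε : ℝ≥0∞) / 2) * D.dist j q s + D.ζ) :=
        add_le_add (hH q hq j q y).2 (hH q hq j q s).2
    _ = (1 + (D.ε : ℝ≥0∞) / 2) * (D.dist j y q + D.dist j q s) + 2 * D.ζ := by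
        rw [D.dist_comm j q y]; ring
    _ ≤ (1 + (D.ε : ℝ≥0∞) / 2) * (d + 2 * D.β) + 2 * D.ζ := by
        have := (add_le_add (D.dist_mono hj y q) (D.dist_mono hj q s)).trans h
        exact add_le_add_left (mul_le_mul_right this _) _
    _ ≤ (1 + (D.ε : ℝ≥0∞)) * d := by
        have := D.stretch_le hε hε1 (ENNReal.coe_lt_coe.1 hthr)
        have h2 : ((D.ε / 2 : ℝ≥0) : ℝ≥0∞) = (D.ε : ℝ≥0∞) / 2 := by
          rw [ENNReal.coe_div two_ne_zero]; rfl
        rw [← h2]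
        exact_mod_cast this

/-- The key `q` minimizing the heap of `w` also serves `y`: go from `q` to `w` and on to `y` inside
the emulator of `q`. Over a distance of at least `β` the additive error `ζ` costs only another
factor `ε/2`. -/
theorem Input.minHeap_div_le_of_far (hε : 0 < D.ε)
    (hH : ∀ q ∈ D.Q, ∀ k : ℕ, IsEmulator (D.graph k) (D.H q k) D.ε D.ζ)
    {d : ℝ≥0∞} (hd : d ≤ 2 ^ i) (hfar : (D.β : ℝ≥0∞) ≤ D.dist k y w)
    (h : D.dist k y w + D.minHeap i k w s / (1 + (D.ε : ℝ≥0∞)) ≤ d) :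
    D.minHeap i k y s / (1 + (D.ε : ℝ≥0∞)) ≤ d := by
  have hd_top : d ≠ ⊤ := ne_top_of_le_ne_top (by finiteness) hd
  have hfin : D.minHeap i k w s ≠ ⊤ := by
    intro hm
    rw [hm, ENNReal.top_div_of_ne_top (by finiteness), add_top, top_le_iff] at h
    exact hd_top h
  obtain ⟨q, hq, hqle⟩ := D.exists_heap_le_minHeap hfin
  refine D.minHeap_div_le hq hd fun j hj => ?_
  have hζ : (D.ζ : ℝ≥0∞) = (D.ε : ℝ≥0∞) / 2 * D.β := by
    have h2 : ((D.ε / 2 : ℝ≥0) : ℝ≥0∞) = (D.ε : ℝ≥0∞) / 2 := by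
      rw [ENNReal.coe_div two_ne_zero]; rfl
    rw [← h2, ← ENNReal.coe_mul, D.half_ε_mul_β hε]
  calc D.distBR q j y s
      ≤ ((D.H q j).dist q w + (D.H q j).dist w y) + (D.H q j).dist q s := by
        unfold Input.distBR
        gcongr
        exact (D.H q j).dist_triangle q w y
    _ = D.distBR q j w s + (D.H q j).dist w y := by unfold Input.distBR; ring
    _ ≤ D.minHeap i k w s + ((1 + (D.ε : ℝ≥0∞) / 2) * D.dist k y w + D.ζ) := by
        refine add_le_add ((D.distBR_le_heap i w s q hj).trans hqle)
          ((hH q hq j w y).2.trans ?_)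
        rw [D.dist_comm k y w]
        gcongr
        exact D.dist_mono hj w y
    _ ≤ D.minHeap i k w s +
          ((1 + (D.ε : ℝ≥0∞) / 2) * D.dist k y w + (D.ε : ℝ≥0∞) / 2 * D.dist k y w) := by
        rw [hζ]; gcongr
    _ = D.minHeap i k w s + (1 + ((D.ε : ℝ≥0∞) / 2 + (D.ε : ℝ≥0∞) / 2)) * D.dist k y w := by
        ring
    _ = (1 + (D.ε : ℝ≥0∞)) *
          (D.dist k y w + D.minHeap i k w s / (1 + (D.ε : ℝ≥0∞))) := by
        rw [ENNReal.add_halves, mul_add, ENNReal.mul_div_cancel (by simp) (by finiteness),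
          add_comm]
    _ ≤ (1 + (D.ε : ℝ≥0∞)) * d := by gcongr

/-- A vertex `b` outside the tree that is not light passes this property on to every vertex `y`
whose candidate distance exceeds the length of a walk through `b`. -/
theorem NotLight.of_lt (hε : 0 < D.ε) (hε1 : D.ε ≤ 1) (hζ : 1 ≤ D.ζ)
    (hH : ∀ q ∈ D.Q, ∀ k : ℕ, IsEmulator (D.graph k) (D.H q k) D.ε D.ζ)
    {T : SimpleGraph V} {b : V} (hb : ¬ InTree s T b)
    (hy : bdist (D.graph k) s T y ≤ 2 ^ i)
    (hby : bdist (D.graph k) s T b + (D.graph k).edist b y ≤ (D.graph k).edist s y)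
    (hlt : (D.graph k).edist s y < bdist (D.graph k) s T y)
    (hN : NotLight D i s k T b) : NotLight D i s k T y := by
  have hβ := D.two_le_β hε hε1 hζ
  have hsy : D.dist k y s + 1 ≤ (bdist (D.graph k) s T y : ℝ≥0∞) := by
    rw [D.dist_comm]
    unfold Input.dist
    exact_mod_cast Order.add_one_le_of_lt hlt
  have hby' : (bdist (D.graph k) s T b : ℝ≥0∞) + D.dist k y b ≤ D.dist k y s := by
    rw [D.dist_comm k y b, D.dist_comm k y s]
    unfold Input.dist
    rw [← ENat.toENNReal_add]
    exact ENat.toENNReal_le.2 hby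
  have hd : (bdist (D.graph k) s T y : ℝ≥0∞) ≤ 2 ^ i := by exact_mod_cast ENat.toENNReal_le.2 hy
  unfold NotLight at hN ⊢
  generalize (bdist (D.graph k) s T y : ℝ≥0∞) = d at *
  generalize (bdist (D.graph k) s T b : ℝ≥0∞) = c at *
  dsimp only at hN ⊢
  have hd_top : d ≠ ⊤ := ne_top_of_le_ne_top (by finiteness) hd
  have hsyd : D.dist k y s ≤ d := le_self_add.trans hsy
  have hcd : c ≤ d := le_self_add.trans (hby'.trans hsyd)
  -- If some `q` is within `β` of `y`, walking to `q`, back to `y` and on to `s` costs at most `d +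
  -- 2β`.
  have near (hthr : (D.threshold : ℝ≥0∞) < d) (hQ : D.distToQ k y < D.β) :
      D.minHeap i k y s / (1 + (D.ε : ℝ≥0∞)) ≤ d := by
    simp only [Input.distToQ, iInf_lt_iff] at hQ
    obtain ⟨q, hq, hyq⟩ := hQ
    refine D.minHeap_div_le_of_near hε hε1 hH hd hthr hq ?_
    calc D.dist k y q + D.dist k q s
        ≤ D.dist k y q + (D.dist k q y + D.dist k y s) := by
          gcongr; exact D.dist_triangle k q y s
      _ ≤ D.β + (D.β + d) := by
          rw [D.dist_comm k q y]; gcongr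
      _ = d + 2 * D.β := by ring
  -- The witness `w` of `b` is tried for `y`. Condition 2 holds unless `y` is near `Q` or far from
  -- `w`, and either exception gives condition 3.
  have via (w : V) (hw : ¬ InTree s T w) (hthr : (D.threshold : ℝ≥0∞) < d)
      (hwd : D.dist k b w + D.minHeap i k w s / (1 + (D.ε : ℝ≥0∞)) ≤ c) :
      (D.β : ℝ≥0∞) ≤ D.distToQ k y ∧ (∃ w : V, D.dist k y w ≤ D.β ∧ ¬ InTree s T w ∧
        D.dist k y w + D.minHeap i k w s / (1 + (D.ε : ℝ≥0∞)) ≤ d) ∨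
      D.minHeap i k y s / (1 + (D.ε : ℝ≥0∞)) ≤ d := by
    have hwd' : D.dist k y w + D.minHeap i k w s / (1 + (D.ε : ℝ≥0∞)) ≤ d :=
      calc _ ≤ (D.dist k y b + D.dist k b w) + D.minHeap i k w s / (1 + (D.ε : ℝ≥0∞)) := by
            gcongr; exact D.dist_triangle k y b w
        _ = (D.dist k b w + D.minHeap i k w s / (1 + (D.ε : ℝ≥0∞))) + D.dist k y b := by ring
        _ ≤ c + D.dist k y b := by gcongr
        _ ≤ d := hby'.trans hsyd
    rcases lt_or_ge (D.distToQ k y) D.β with hQ | hQ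
    · exact Or.inr (near hthr hQ)
    rcases le_total (D.dist k y w) D.β with hyw | hyw
    · exact Or.inl ⟨hQ, w, hyw, hw, hwd'⟩
    · exact Or.inr (D.minHeap_div_le_of_far hε hH hd hyw hwd')
  rcases hN with ⟨-, hQ⟩ | ⟨hthr, -, w, -, hw, hwd⟩ | ⟨hthr, hbd⟩
  · have hQd : D.distQ k y s ≤ d + 1 :=
      calc D.distQ k y s ≤ D.dist k y b + (c + 2) :=
            (D.distQ_le_add k y b s).trans (by gcongr)
        _ = (c + D.dist k y b) + 1 + 1 := by rw [show (2 : ℝ≥0∞) = 1 + 1 by norm_num]; ring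
        _ ≤ D.dist k y s + 1 + 1 := by gcongr
        _ ≤ d + 1 := by gcongr
    rcases le_or_gt d D.threshold with hthr | hthr
    · exact Or.inl ⟨hthr, hQd.trans (by gcongr; norm_num)⟩
    -- Here `b` is short but `y` is long: the exact route through `Q` must be turned into a heap
    -- bound, the additive slack being well below `2β`.
    · refine Or.inr (Or.inr ⟨hthr, ?_⟩)
      have hlt : D.distQ k y s < d + 2 * D.β := by
        refine hQd.trans_lt (ENNReal.add_lt_add_left hd_top ?_)
        have : (1 : ℝ≥0) < 2 * D.β :=
          lt_of_lt_of_le (by norm_num) (mul_le_mul_of_nonneg_left hβ zero_le_two)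
        exact_mod_cast this
      simp only [Input.distQ, iInf_lt_iff] at hlt
      obtain ⟨q, hq, hyq⟩ := hlt
      exact D.minHeap_div_le_of_near hε hε1 hH hd hthr hq hyq.le
  · have hthr' := hthr.trans_le hcd
    rcases via w hw hthr' hwd with h | h
    · exact Or.inr (Or.inl ⟨hthr', h⟩)
    · exact Or.inr (Or.inr ⟨hthr', h⟩)
  · have hthr' := hthr.trans_le hcd
    have hbb : D.dist k b b = 0 := by simp [Input.dist]
    -- Under condition 3 the vertex `b`, itself outside the tree, is the witness.
    rcases via b hb hthr' (by rwa [hbb, zero_add]) with h | h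
    · exact Or.inr (Or.inl ⟨hthr', h⟩)
    · exact Or.inr (Or.inr ⟨hthr', h⟩)

end Light

/-! ### The invariant and its preservation by each step. -/

section Trees

variable {V : Type*}

theorem exists_exit {G T : SimpleGraph V} {s : V}
    (hex : ∀ u, InTree s T u → T.edist s u ≤ G.edist s u) {x y : V} (p : G.Walk x y)
    (hx : InTree s T x) (hy : ¬ InTree s T y) :
    ∃ b, ¬ InTree s T b ∧ bdist G s T b + G.edist b y ≤ G.edist s x + p.length := by
  induction p with
  | nil => exact absurd hx hy
  | @cons u v z h p ih =>
    by_cases hv : InTree s T v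
    · obtain ⟨b, hb, hle⟩ := ih hv hy
      refine ⟨b, hb, hle.trans ?_⟩
      calc G.edist s v + p.length ≤ (G.edist s u + G.edist u v) + p.length := by
            gcongr; exact SimpleGraph.edist_triangle
        _ = G.edist s u + (Walk.cons h p).length := by
            rw [SimpleGraph.edist_eq_one_iff_adj.2 h, Walk.length_cons]; push_cast; ring
    · refine ⟨v, hv, ?_⟩
      calc bdist G s T v + G.edist v z ≤ (T.edist s u + 1) + p.length :=
            add_le_add (iInf₂_le u ⟨h.symm, hx⟩) (edist_le p)
        _ ≤ (G.edist s u + 1) + p.length := add_le_add_left (add_le_add_left (hex u hx) 1) _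
        _ = G.edist s u + (Walk.cons h p).length := by
            rw [Walk.length_cons]; push_cast; ring

/-- Paths in a forest are unique, so a path surviving in `T'` is the shortest one in `T`. -/
theorem edist_le_of_isAcyclic {T T' : SimpleGraph V} (hT : T.IsAcyclic) (hle : T' ≤ T) {s u : V}
    (h : T'.Reachable s u) : T'.edist s u ≤ T.edist s u := by
  classical
  obtain ⟨p, hp⟩ := h.exists_isPath
  obtain ⟨q, hq, hql⟩ := (h.mono hle).exists_path_of_dist
  have hpq : p.mapLe hle = q :=
    congrArg Subtype.val ((hT.subsingleton_path s u).elim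
      ⟨p.mapLe hle, hp.mapLe hle⟩ ⟨q, hq⟩)
  calc T'.edist s u ≤ p.length := edist_le p
    _ = q.length := by rw [← hpq, Walk.length_map]
    _ = T.edist s u := by rw [hql, (h.mono hle).coe_dist_eq_edist]

theorem cutTree_le (s : V) (T : SimpleGraph V) (e : Sym2 V) : cutTree s T e ≤ T.deleteEdges {e} :=
  fun _ _ h => h.1

theorem reachable_cutTree {s : V} {T : SimpleGraph V} {e : Sym2 V} {a : V}
    (h : (T.deleteEdges {e}).Reachable s a) : (cutTree s T e).Reachable s a := by
  rw [SimpleGraph.reachable_iff_reflTransGen] at h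
  induction h with
  | refl => exact Reachable.rfl
  | tail hab hbc ih =>
    refine ih.trans (Adj.reachable ⟨hbc, ?_⟩)
    rwa [SimpleGraph.reachable_iff_reflTransGen]

/-- What holds at every moment of the maintenance of `T(s)`. -/
structure Invariant (D : Input V) (s : V) (σ : State V) : Prop where
  acyclic : σ.tree.IsAcyclic
  reachable_of_adj : ∀ a b, σ.tree.Adj a b → InTree s σ.tree a
  le : σ.tree ≤ D.graph σ.time
  exact : ∀ u, InTree s σ.tree u → σ.tree.edist s u ≤ (D.graph σ.time).edist s u
  old_le : ∀ u, σ.old u ≠ ⊤ → σ.old u ≤ (D.graph σ.time).edist s u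

theorem Invariant.init (D : Input V) (s : V) : Invariant D s (State.init V) where
  acyclic := isAcyclic_bot
  reachable_of_adj _ _ h := h.elim
  le := bot_le
  exact u h := by
    obtain rfl : s = u := reachable_bot.1 h
    simp
  old_le _ h := absurd rfl h

theorem Invariant.connect {D : Input V} {s : V} {σ : State V} (h : Invariant D s σ) {y x : V}
    (hy : ¬ InTree s σ.tree y) (hx : IsBest D s σ y x)
    (hle : bdist (D.graph σ.time) s σ.tree y ≤ (D.graph σ.time).edist s y) :
    Invariant D s { σ with tree := σ.tree ⊔ SimpleGraph.edge x y } := by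
  obtain ⟨hadj, hxT, hbest⟩ := hx
  have hxy : x ≠ y := fun e => hy (e ▸ hxT)
  have hsub : σ.tree ≤ σ.tree ⊔ SimpleGraph.edge x y := le_sup_left
  have hedge : (σ.tree ⊔ SimpleGraph.edge x y).Adj x y := by
    simp [SimpleGraph.edge_adj, hxy]
  have hx' : InTree s (σ.tree ⊔ SimpleGraph.edge x y) x := hxT.mono hsub
  -- All edges lie in the component of `s`, so `y` was isolated and brings no further vertices with
  -- it.
  have hcases : ∀ u, InTree s (σ.tree ⊔ SimpleGraph.edge x y) u → InTree s σ.tree u ∨ u = y := by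
    intro u hu
    rw [InTree, SimpleGraph.reachable_iff_reflTransGen] at hu
    induction hu with
    | refl => exact Or.inl Reachable.rfl
    | @tail b c _ hbc ih =>
      rw [SimpleGraph.sup_adj, SimpleGraph.edge_adj] at hbc
      rcases hbc with hbc | ⟨⟨-, rfl⟩ | ⟨-, rfl⟩, -⟩
      · exact Or.inl (h.reachable_of_adj _ _ hbc.symm)
      · exact Or.inr rfl
      · exact Or.inl hxT
  refine ⟨h.acyclic.sup_edge_of_not_reachable fun hr => hy (hxT.trans hr), ?_, ?_, ?_, h.old_le⟩
  · intro a b hab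
    have hab' := hab
    rw [SimpleGraph.sup_adj, SimpleGraph.edge_adj] at hab'
    rcases hab' with hab' | ⟨⟨rfl, -⟩ | ⟨rfl, -⟩, -⟩
    · exact (h.reachable_of_adj _ _ hab').mono hsub
    · exact hx'
    · exact hx'.trans hedge.reachable
  · refine sup_le h.le fun a b hab => ?_
    rw [SimpleGraph.edge_adj] at hab
    rcases hab with ⟨⟨rfl, rfl⟩ | ⟨rfl, rfl⟩, -⟩
    · exact hadj.symm
    · exact hadj
  · intro u hu
    rcases hcases u hu with hu | rfl
    · exact (edist_anti hsub).trans (h.exact u hu)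
    · calc (σ.tree ⊔ SimpleGraph.edge x u).edist s u
          ≤ (σ.tree ⊔ SimpleGraph.edge x u).edist s x +
              (σ.tree ⊔ SimpleGraph.edge x u).edist x u := SimpleGraph.edist_triangle
        _ ≤ σ.tree.edist s x + 1 :=
            add_le_add (edist_anti hsub) (SimpleGraph.edist_eq_one_iff_adj.2 hedge).le
        _ ≤ (D.graph σ.time).edist s u := hbest.trans_le hle

theorem Invariant.delete {D : Input V} {s : V} {σ : State V} (h : Invariant D s σ) :
    Invariant D s
      { time := σ.time + 1
        tree := cutTree s σ.tree (D.deleted σ.time)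
        old := fun v => σ.tree.edist s v } := by
  have hle : cutTree s σ.tree (D.deleted σ.time) ≤ σ.tree :=
    (cutTree_le _ _ _).trans (deleteEdges_le _)
  refine ⟨h.acyclic.anti hle, fun a b hab => reachable_cutTree hab.2, ?_, ?_, ?_⟩
  · exact (cutTree_le _ _ _).trans (deleteEdges_mono h.le)
  · intro u hu
    exact (edist_le_of_isAcyclic h.acyclic hle hu).trans
      ((h.exact u (hu.mono hle)).trans (edist_anti (D.graph_antitone (Nat.le_succ _))))
  · intro u hu
    exact (h.exact u (SimpleGraph.edist_ne_top_iff_reachable.1 hu)).trans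
      (edist_anti (D.graph_antitone (Nat.le_succ _)))

theorem Invariant.bdist_le_of_canAccept {D : Input V} {i : ℕ} {s : V} {σ : State V}
    (h : Invariant D s σ) (hε : 0 < D.ε) (hε1 : D.ε ≤ 1) (hζ : 1 ≤ D.ζ)
    (hH : ∀ q ∈ D.Q, ∀ k : ℕ, IsEmulator (D.graph k) (D.H q k) D.ε D.ζ)
    {y : V} (hy : CanAccept D i s σ y)
    (hmin : ∀ z : V, CanKeep D s σ z ∨ CanAccept D i s σ z →
      bdist (D.graph σ.time) s σ.tree y ≤ bdist (D.graph σ.time) s σ.tree z) :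
    bdist (D.graph σ.time) s σ.tree y ≤ (D.graph σ.time).edist s y := by
  by_contra! hlt
  obtain ⟨p, hp⟩ := exists_walk_of_edist_ne_top hlt.ne_top
  obtain ⟨b, hb, hby⟩ := exists_exit h.exact p Reachable.rfl hy.1
  rw [SimpleGraph.edist_self, zero_add, hp] at hby
  have hblt : bdist (D.graph σ.time) s σ.tree b < bdist (D.graph σ.time) s σ.tree y :=
    (le_self_add.trans hby).trans_lt hlt
  have hN : NotLight D i s σ.time σ.tree b := by
    by_contra hN
    -- If `b` passed the test it would be a candidate closer than `y`, against the minimality of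
    -- `y`.
    exact (hmin b (Or.inr ⟨hb, hblt.le.trans hy.2.1, hN⟩)).not_gt hblt
  exact hy.2.2 (hN.of_lt hε hε1 hζ hH hb hy.2.1 hby hlt)

theorem Invariant.step {D : Input V} {i : ℕ} {s : V} {σ τ : State V}
    (h : Invariant D s σ) (hε : 0 < D.ε) (hε1 : D.ε ≤ 1) (hζ : 1 ≤ D.ζ)
    (hH : ∀ q ∈ D.Q, ∀ k : ℕ, IsEmulator (D.graph k) (D.H q k) D.ε D.ζ)
    (hστ : Step D i s σ τ) : Invariant D s τ := by
  cases hστ with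
  | keep y x hy hx => exact h.connect hy.1 hx (hy.2.2.trans (h.old_le y hy.2.1))
  | accept y x hy hx hmin =>
    exact h.connect hy.1 hx (h.bdist_le_of_canAccept hε hε1 hζ hH hy hmin)
  | delete hdone => exact h.delete

theorem Occurs.invariant {D : Input V} {i : ℕ} {s : V} {σ : State V}
    (hε : 0 < D.ε) (hε1 : D.ε ≤ 1) (hζ : 1 ≤ D.ζ)
    (hH : ∀ q ∈ D.Q, ∀ k : ℕ, IsEmulator (D.graph k) (D.H q k) D.ε D.ζ)
    (hσ : Occurs D i s σ) : Invariant D s σ := by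
  unfold Occurs Later at hσ
  induction hσ with
  | refl => exact Invariant.init D s
  | tail _ hstep ih => exact ih.step hε hε1 hζ hH hstep

theorem Invariant.edist_eq {D : Input V} {s : V} {σ : State V} (h : Invariant D s σ) {u : V}
    (hu : InTree s σ.tree u) : σ.tree.edist u s = (D.graph σ.time).edist u s := by
  rw [SimpleGraph.edist_comm, SimpleGraph.edist_comm (G := D.graph σ.time)]
  exact (h.exact u hu).antisymm (edist_anti h.le)

theorem Later.time_le {D : Input V} {i : ℕ} {s : V} {σ τ : State V} (h : Later D i s σ τ) :
    σ.time ≤ τ.time := by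
  unfold Later at h
  induction h with
  | refl => exact le_rfl
  | tail _ hstep ih =>
    refine ih.trans ?_
    cases hstep with
    | keep => exact le_rfl
    | accept => exact le_rfl
    | delete => exact Nat.le_succ _

end Trees

end LightTree

theorem mainTheorem3 {V : Type*} [Fintype V] (D : LightTree.Input V)
    (hε : 0 < D.ε) (hε1 : D.ε ≤ 1) (hζ : 1 ≤ D.ζ)
    (hH : ∀ q ∈ D.Q, ∀ k : ℕ, LightTree.IsEmulator (D.graph k) (D.H q k) D.ε D.ζ)
    (S : ℕ → Finset V) (i : ℕ) (s : V) (hs : s ∈ S i) :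
    (∀ σ : LightTree.State V, LightTree.Occurs D i s σ →
      ∀ u : V, LightTree.InTree s σ.tree u →
        σ.tree.edist u s = (D.graph σ.time).edist u s) ∧
    (∀ σ τ : LightTree.State V, LightTree.Occurs D i s σ → LightTree.Later D i s σ τ →
      ∀ u : V, LightTree.InTree s σ.tree u → LightTree.InTree s τ.tree u →
        σ.tree.edist u s ≤ τ.tree.edist u s) := by
  refine ⟨fun σ hσ u hu => (hσ.invariant hε hε1 hζ hH).edist_eq hu, ?_⟩
  intro σ τ hσ hστ u hu hu'
  have hτ : LightTree.Occurs D i s τ := Relation.ReflTransGen.trans hσ hστ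
  rw [(hσ.invariant hε hε1 hζ hH).edist_eq hu, (hτ.invariant hε hε1 hζ hH).edist_eq hu']
  -- Both tree distances are now graph distances, and the later graph has fewer edges.
  exact SimpleGraph.edist_anti (D.graph_antitone hστ.time_le)
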